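/- Let $M$ be a compact connected ($C^\infty$, finite-dimensional) Riemannian manifold, possibly with boundary $\partial M$, and let $U,V\subset M$ be open subsets with smooth boundaries (that is, the topological boundaries of $U$ and $V$ in $M$ are smooth hypersurfaces, possibly empty), such that $\bar U\cap\bar V=\emptyset$ and $\partial M\subset U$. Then there exists a $C^\infty$ function $\eta:M\to[0,1]$ such that $\eta\equiv 1$ on $\bar U$, $\eta\equiv 0$ on $\bar V$, $\eta(x)\in(0,1)$ for every $x\in M\setminus(\bar U\cup\bar V)$, and the function \[ \frac{\|\nabla^2\eta\|^2}{|\eta|} \] is bounded on $M\setminus\bar V$. Here $\nabla^2\eta(X,Y)=X(Y\eta)-(\nabla_XY)\eta$ is the Hessian of $\eta$ with respect to the Levi-Civita connection $\nabla$, in local coordinates $\nabla^2\eta(\partial_i,\partial_j)=\frac{\partial^2\eta}{\partial x_i\partial x_j}-\sum_k\Gamma_{ij}^k\frac{\partial\eta}{\partial x_k}$, and $\|\nabla^2\eta(p)\|^2=\sum_{i,j}\bigl(\nabla^2\eta(p)(e_i,e_j)\bigr)^2$ for any orthonormal basis $(e_i)$ of $T_pM$. -/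

import Mathlib

open scoped Manifold ContDiff

noncomputable section

namespace RiemHess

/-! ### Christoffel symbols and Hessian in coordinates -/

section Coordinates

variable {E : Type*} [NormedAddCommGroup E] [NormedSpace ℝ E]

/-- Christoffel symbols of the first kind, as a covector, of a metric `G` on a set `S` of
coordinates: `w ↦ (∂_u G(v, w) + ∂_v G(u, w) - ∂_w G(u, v)) / 2`. -/
def christoffelFirst (S : Set E) (G : E → E →L[ℝ] E →L[ℝ] ℝ) (y u v : E) : E →L[ℝ] ℝ :=
  let DG : E →L[ℝ] E →L[ℝ] E →L[ℝ] ℝ := fderivWithin ℝ G S y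
  (1 / 2 : ℝ) • (DG u v + DG v u - (DG.flip u).flip v)

theorem christoffelFirst_apply (S : Set E) (G : E → E →L[ℝ] E →L[ℝ] ℝ) (y u v w : E) :
    christoffelFirst S G y u v w = (fderivWithin ℝ G S y u v w + fderivWithin ℝ G S y v u w
      - fderivWithin ℝ G S y w u v) / 2 := by
  simp [christoffelFirst]
  ring

/-- Christoffel symbols (of the second kind) of a metric `G` on a set `S` of coordinates, as a
vector-valued bilinear form: `christoffel S G y u v` is the vector `Γ` with
`G(Γ, w) = (∂_u G(v, w) + ∂_v G(u, w) - ∂_w G(u, v)) / 2` for all `w`, in other words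
the vector `∑ u_i v_j Γ_{ij}^k ∂_k`. -/
def christoffel (S : Set E) (G : E → E →L[ℝ] E →L[ℝ] ℝ) (y u v : E) : E :=
  (G y).inverse (christoffelFirst S G y u v)

/-- The Hessian `∂_u ∂_v F - ∂_{Γ(u, v)} F` at `y` of a function `F` of the coordinates; on basis
vectors it is `∂_i ∂_j F - ∑_k Γ_{ij}^k ∂_k F`. -/
def coordHessian (S : Set E) (G : E → E →L[ℝ] E →L[ℝ] ℝ) (F : E → ℝ) (y u v : E) : ℝ :=
  fderivWithin ℝ (fderivWithin ℝ F S) S y u v - fderivWithin ℝ F S y (christoffel S G y u v)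

end Coordinates

/-! ### Hessian on a Riemannian manifold -/

section Manifold

variable {E : Type*} [NormedAddCommGroup E] [NormedSpace ℝ E]
  {H : Type*} [TopologicalSpace H] {I : ModelWithCorners ℝ E H}
  {M : Type*} [TopologicalSpace M] [ChartedSpace H M] [IsManifold I ∞ M]

/-- The metric `g` read in the chart centred at `c`: `coordMetric g c y u v` is the inner product,
at the point with coordinates `y`, of the tangent vectors with coordinates `u` and `v`. -/
def coordMetric (g : Bundle.ContMDiffRiemannianMetric I ∞ E (fun x : M => TangentSpace I x))
    (c : M) (y : E) : E →L[ℝ] E →L[ℝ] ℝ :=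
  let A : E →L[ℝ] E := mfderivWithin 𝓘(ℝ, E) I (extChartAt I c).symm (Set.range I) y
  let B : E →L[ℝ] E →L[ℝ] ℝ := g.inner ((extChartAt I c).symm y)
  B.bilinearComp A A

/-- The Hessian of `f` at `x`, applied to the tangent vectors `u` and `v` and computed in the chart
centred at `c` (whose domain should contain `x`). -/
def hessianInChart (g : Bundle.ContMDiffRiemannianMetric I ∞ E (fun x : M => TangentSpace I x))
    (c : M) (f : M → ℝ) (x : M) (u v : TangentSpace I x) : ℝ :=
  let D : TangentSpace I x →L[ℝ] E := mfderiv I 𝓘(ℝ, E) (extChartAt I c) x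
  coordHessian (Set.range I) (coordMetric g c) (f ∘ (extChartAt I c).symm) (extChartAt I c x)
    (D u) (D v)

/-- The Hessian `∇²f(u, v)` of `f` at `x` with respect to the Levi-Civita connection of `g`. It is
computed in the preferred chart around `x`. -/
def hessian (g : Bundle.ContMDiffRiemannianMetric I ∞ E (fun x : M => TangentSpace I x))
    (f : M → ℝ) (x : M) (u v : TangentSpace I x) : ℝ :=
  hessianInChart g x f x u v

/-- The basis `e` of the tangent space at `x` is orthonormal for the metric `g`. -/
def IsOrthonormalBasis (g : Bundle.ContMDiffRiemannianMetric I ∞ E (fun x : M => TangentSpace I x))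
    {x : M} {ι : Type*} (e : Module.Basis ι ℝ (TangentSpace I x)) : Prop :=
  (∀ i, g.inner x (e i) (e i) = 1) ∧ ∀ i j, i ≠ j → g.inner x (e i) (e j) = 0

/-- The squared norm `∑_{i,j} (∇²f(e_i, e_j))²` of the Hessian of `f` at `x`, computed in the
basis `e`; it is the same number `‖∇²f‖²` for all orthonormal bases `e`. -/
def hessianNormSq (g : Bundle.ContMDiffRiemannianMetric I ∞ E (fun x : M => TangentSpace I x))
    (f : M → ℝ) {x : M} {ι : Type*} [Fintype ι] (e : Module.Basis ι ℝ (TangentSpace I x)) : ℝ :=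
  ∑ i, ∑ j, (hessian g f x (e i) (e j)) ^ 2

variable (I) in
/-- The topological boundary of `U` is a smooth hypersurface: near each of its points it is the
zero set of a smooth function whose differential does not vanish at that point. -/
def HasSmoothBoundary (U : Set M) : Prop :=
  ∀ p ∈ frontier U, ∃ W : Set M, IsOpen W ∧ p ∈ W ∧
    ∃ φ : M → ℝ, ContMDiffOn I 𝓘(ℝ, ℝ) ∞ φ W ∧ mfderiv I 𝓘(ℝ, ℝ) φ p ≠ 0 ∧
      frontier U ∩ W = {x ∈ W | φ x = 0}

end Manifold

end RiemHess

end

noncomputable section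

set_option maxSynthPendingDepth 3

namespace RiemHess

open Set Filter Topology Bundle

/-! ### The Hessian in coordinates: change of variables and local bounds. -/

section Coordinates

variable {E : Type*} [NormedAddCommGroup E] [NormedSpace ℝ E]

/-! Take a smooth `f : M → [0, 1]` vanishing exactly on the closure of `V` and equal to `1` exactly
on the closure of `U`, and put `η = f ^ 4`. Since `∇²(f ^ k) = k f ^ (k-1) ∇²f + k (k-1) f ^ (k-2)
df ⊗ df`, the squared Hessian is `O(f ^ (2k-4))`, and this is `O(f ^ k)` as soon as `k ≥ 4`; so `k =
4` is the least exponent for which this estimate suffices.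

The bound must be uniform in the point, whereas `hessian` uses the preferred chart of each point,
which need not vary continuously. In one fixed chart, `df` and `∇²f` are bounded near the centre on
vectors of metric length at most `1` (`exists_eventually_coordHessian_le`). Chart independence
(`coordHessian_comp`, `hessianInChart_eq`) transfers this bound to `hessian`, and compactness leaves
finitely many charts. Derivatives are taken within `range I` throughout, so boundary points need no
separate treatment. -/

/-- A positive definite bilinear form on a finite-dimensional space is invertible as a map to
the dual space. -/
theorem isInvertible_of_pos [FiniteDimensional ℝ E] {B : E →L[ℝ] E →L[ℝ] ℝ}
    (hB : ∀ v, v ≠ 0 → 0 < B v v) : B.IsInvertible := by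
  have hinj : Function.Injective (B : E →ₗ[ℝ] E →L[ℝ] ℝ) := by
    rw [← LinearMap.ker_eq_bot, LinearMap.ker_eq_bot']
    intro v hv
    by_contra h
    have := hB v h
    rw [show B v = 0 from hv] at this
    simp at this
  have hdim : Module.finrank ℝ E = Module.finrank ℝ (E →L[ℝ] ℝ) := by
    rw [← Subspace.dual_finrank_eq (K := ℝ) (V := E)]
    exact LinearEquiv.finrank_eq LinearMap.toContinuousLinearMap
  let e := (LinearEquiv.ofInjectiveOfFinrankEq (B : E →ₗ[ℝ] E →L[ℝ] ℝ) hinj hdim)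
  refine ⟨e.toContinuousLinearEquiv, ?_⟩
  ext v w
  rfl

theorem metric_christoffel_apply {S : Set E} {G : E → E →L[ℝ] E →L[ℝ] ℝ} {y : E}
    (h : (G y).IsInvertible) (u v w : E) :
    G y (christoffel S G y u v) w = (fderivWithin ℝ G S y u v w + fderivWithin ℝ G S y v u w
      - fderivWithin ℝ G S y w u v) / 2 := by
  rw [christoffel, h.self_apply_inverse, christoffelFirst_apply]

variable {S : Set E} {G G' : E → E →L[ℝ] E →L[ℝ] ℝ} {F F' : E → ℝ} {τ : E → E} {y : E}

theorem _root_.ContDiffWithinAt.differentiableWithinAt_fderivWithin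
    {V : Type*} [NormedAddCommGroup V] [NormedSpace ℝ V] {f : E → V}
    (hf : ContDiffWithinAt ℝ 2 f S y) (hS : UniqueDiffOn ℝ S) (hy : y ∈ S) :
    DifferentiableWithinAt ℝ (fderivWithin ℝ f S) S y :=
  (hf.fderivWithin_right (m := 1) hS (by norm_num) hy).differentiableWithinAt one_ne_zero

theorem _root_.ContDiffWithinAt.eventually_differentiableWithinAt
    {V : Type*} [NormedAddCommGroup V] [NormedSpace ℝ V] {f : E → V}
    (hf : ContDiffWithinAt ℝ 2 f S y) (hy : y ∈ S) :
    ∀ᶠ z in 𝓝[S] y, DifferentiableWithinAt ℝ f S z := by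
  have := hf.eventually (by simp)
  rw [insert_eq_of_mem hy] at this
  exact this.mono fun z hz => hz.differentiableWithinAt (by simp)

/-- The derivative of the pullback of a metric. -/
theorem fderivWithin_pullback_metric (hS : UniqueDiffOn ℝ S) (hy : y ∈ S)
    (hτ : ContDiffWithinAt ℝ 2 τ S y) (hτS : ∀ᶠ z in 𝓝[S] y, τ z ∈ S)
    (hG' : DifferentiableWithinAt ℝ G' S (τ y)) (hGd : DifferentiableWithinAt ℝ G S y)
    (hGG' : ∀ᶠ z in 𝓝[S] y, ∀ v w,
      G z v w = G' (τ z) (fderivWithin ℝ τ S z v) (fderivWithin ℝ τ S z w)) (u v w : E) :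
    fderivWithin ℝ G S y u v w =
      fderivWithin ℝ G' S (τ y) (fderivWithin ℝ τ S y u) (fderivWithin ℝ τ S y v)
        (fderivWithin ℝ τ S y w)
      + G' (τ y) (fderivWithin ℝ (fderivWithin ℝ τ S) S y u v) (fderivWithin ℝ τ S y w)
      + G' (τ y) (fderivWithin ℝ τ S y v) (fderivWithin ℝ (fderivWithin ℝ τ S) S y u w) := by
  have hτt : Tendsto τ (𝓝[S] y) (𝓝[S] (τ y)) :=
    tendsto_nhdsWithin_iff.2 ⟨hτ.continuousWithinAt, hτS⟩
  have h1 : HasFDerivWithinAt (fun z => G z v w) _ S y :=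
    (hGd.hasFDerivWithinAt.clm_apply (hasFDerivWithinAt_const v y S)).clm_apply
      (hasFDerivWithinAt_const w y S)
  have hA := (hτ.differentiableWithinAt_fderivWithin hS hy).hasFDerivWithinAt
  have hc : HasFDerivWithinAt (fun z => G' (τ z))
      ((fderivWithin ℝ G' S (τ y)).comp (fderivWithin ℝ τ S y)) S y :=
    HasFDerivWithinAt.comp_of_tendsto (g := G') y hG'.hasFDerivWithinAt
      (hτ.differentiableWithinAt (by simp)).hasFDerivWithinAt hτt
  have h2 := (hc.clm_apply (hA.clm_apply (hasFDerivWithinAt_const v y S))).clm_apply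
      (hA.clm_apply (hasFDerivWithinAt_const w y S))
  have h3 : (fun z => G z v w) =ᶠ[𝓝[S] y]
      fun z => G' (τ z) (fderivWithin ℝ τ S z v) (fderivWithin ℝ τ S z w) :=
    hGG'.mono fun z hz => hz v w
  have h4 := (h2.congr_of_eventuallyEq h3 (hGG'.self_of_nhdsWithin hy v w))
  have h5 := congrArg (fun L : E →L[ℝ] ℝ => L u) ((hS y hy).eq h1 h4)
  simp at h5
  linarith

/-- The Hessian in coordinates does not depend on the coordinates. -/
theorem coordHessian_comp (hS : UniqueDiffOn ℝ S) (hy : y ∈ S) (hy' : y ∈ closure (interior S))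
    (hτ : ContDiffWithinAt ℝ 2 τ S y) (hτS : ∀ᶠ z in 𝓝[S] y, τ z ∈ S)
    (hF' : ContDiffWithinAt ℝ 2 F' S (τ y)) (hFF' : F =ᶠ[𝓝[S] y] F' ∘ τ)
    (hG' : DifferentiableWithinAt ℝ G' S (τ y)) (hGd : DifferentiableWithinAt ℝ G S y)
    (hGG' : ∀ᶠ z in 𝓝[S] y, ∀ v w,
      G z v w = G' (τ z) (fderivWithin ℝ τ S z v) (fderivWithin ℝ τ S z w))
    (hsymm : ∀ v w, G' (τ y) v w = G' (τ y) w v)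
    (hinv : (G y).IsInvertible) (hinv' : (G' (τ y)).IsInvertible)
    (hA : Function.Surjective (fderivWithin ℝ τ S y)) (u v : E) :
    coordHessian S G F y u v =
      coordHessian S G' F' (τ y) (fderivWithin ℝ τ S y u) (fderivWithin ℝ τ S y v) := by
  have hτy : τ y ∈ S := hτS.self_of_nhdsWithin hy
  have hτt : Tendsto τ (𝓝[S] y) (𝓝[S] (τ y)) :=
    tendsto_nhdsWithin_iff.2 ⟨hτ.continuousWithinAt, hτS⟩
  -- Symmetry of the second derivative holds even at boundary points of `S`, because they are limits
  -- of interior points.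
  have hD2 : IsSymmSndFDerivWithinAt ℝ τ S y :=
    hτ.isSymmSndFDerivWithinAt (by simp) hS hy' hy
  set A := fderivWithin ℝ τ S y with hAdef
  set B := fderivWithin ℝ (fderivWithin ℝ τ S) S y with hBdef
  -- The transformation law of Christoffel symbols, tested against vectors `A w`. In the Koszul
  -- combination of `key`, the second-derivative terms cancel by symmetry except for two copies of
  -- `G'(B u v, A w)`.
  have hΓ : A (christoffel S G y u v) = christoffel S G' (τ y) (A u) (A v) + B u v := by
    apply hinv'.injective
    ext w'
    obtain ⟨w, rfl⟩ := hA w'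
    have e1 := hGG'.self_of_nhdsWithin hy (christoffel S G y u v) w
    rw [← hAdef, metric_christoffel_apply hinv] at e1
    have key := fderivWithin_pullback_metric hS hy hτ hτS hG' hGd hGG'
    rw [← e1, map_add, _root_.add_apply, metric_christoffel_apply hinv',
      key u v w, key v u w, key w u v]
    simp only [← hAdef, ← hBdef]
    rw [hsymm (A u) (B w v), show B v u = B u v from hD2 v u, show B w u = B u w from hD2 w u,
      show B w v = B v w from hD2 w v, hsymm (A v) (B u w), hsymm (A u) (B v w)]
    ring
  have hder : ∀ᶠ z in 𝓝[S] y, fderivWithin ℝ F S z =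
      (fderivWithin ℝ F' S (τ z)).comp (fderivWithin ℝ τ S z) := by
    filter_upwards [eventually_eventually_nhdsWithin.2 hτS, self_mem_nhdsWithin,
      hτ.eventually_differentiableWithinAt hy,
      hτt.eventually (hF'.eventually_differentiableWithinAt hτy),
      eventually_eventually_nhdsWithin.2 hFF'] with z h1 h2 h3 h4 h5
    rw [EventuallyEq.fderivWithin_eq h5 (h5.self_of_nhdsWithin h2)]
    exact (h4.hasFDerivWithinAt.comp_of_tendsto z h3.hasFDerivWithinAt
      (tendsto_nhdsWithin_iff.2 ⟨h3.continuousWithinAt, h1⟩)).fderivWithin (hS z h2)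
  have hA' := (hτ.differentiableWithinAt_fderivWithin hS hy).hasFDerivWithinAt
  have hF'2 : HasFDerivWithinAt (fun z => fderivWithin ℝ F' S (τ z)) _ S y :=
    (hF'.differentiableWithinAt_fderivWithin hS hτy).hasFDerivWithinAt.comp_of_tendsto y
      (hτ.differentiableWithinAt (by simp)).hasFDerivWithinAt hτt
  have h2 := ((hF'2.clm_comp hA').congr_of_eventuallyEq hder
    (hder.self_of_nhdsWithin hy)).fderivWithin (hS y hy)
  rw [coordHessian, coordHessian, h2, hder.self_of_nhdsWithin hy, ContinuousLinearMap.comp_apply,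
    ← hAdef, hΓ]
  simp [← hBdef]
  ring

/-! ### Fourth powers and local estimates. -/

theorem coordHessian_pow_four (hS : UniqueDiffOn ℝ S) (hy : y ∈ S)
    (hF : ContDiffWithinAt ℝ 2 F S y) (u v : E) :
    coordHessian S G (fun z => F z ^ 4) y u v = 4 * F y ^ 3 * coordHessian S G F y u v +
      12 * F y ^ 2 * (fderivWithin ℝ F S y u * fderivWithin ℝ F S y v) := by
  have hder : ∀ᶠ z in 𝓝[S] y, fderivWithin ℝ (fun z => F z ^ 4) S z =
      (4 * F z ^ 3) • fderivWithin ℝ F S z := by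
    filter_upwards [self_mem_nhdsWithin, hF.eventually_differentiableWithinAt hy] with z h1 h2
    simpa using (h2.hasFDerivWithinAt.pow 4).fderivWithin (hS z h1)
  have h0 := (hF.differentiableWithinAt (by simp)).hasFDerivWithinAt
  have h1 := ((((h0.pow 3).const_mul 4).smul
    (hF.differentiableWithinAt_fderivWithin hS hy).hasFDerivWithinAt).congr_of_eventuallyEq hder
    (hder.self_of_nhdsWithin hy)).fderivWithin (hS y hy)
  rw [coordHessian, coordHessian, h1, hder.self_of_nhdsWithin hy]
  simp
  ring

/-- The constant is the minimum of the quadratic form on the compact unit sphere; homogeneity does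
the rest. The sphere is empty when `E` is trivial. -/
theorem exists_le_of_pos [FiniteDimensional ℝ E] {B : E →L[ℝ] E →L[ℝ] ℝ}
    (hB : ∀ v, v ≠ 0 → 0 < B v v) : ∃ m > 0, ∀ v, m * ‖v‖ ^ 2 ≤ B v v := by
  have : ProperSpace E := FiniteDimensional.proper ℝ E
  rcases (Metric.sphere (0 : E) 1).eq_empty_or_nonempty with h | h
  · refine ⟨1, one_pos, fun v => ?_⟩
    have hv : v = 0 := by
      by_contra hv
      have : ‖v‖⁻¹ • v ∈ Metric.sphere (0 : E) 1 := by simp [norm_smul, hv]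
      simp [h] at this
    simp [hv]
  · obtain ⟨w, hw, hmin⟩ := (isCompact_sphere (0 : E) 1).exists_isMinOn h
      (f := fun v => B v v) (by fun_prop)
    have hw0 : w ≠ 0 := by
      rintro rfl
      simp at hw
    refine ⟨B w w, hB w hw0, fun v => ?_⟩
    rcases eq_or_ne v 0 with rfl | hv
    · simp
    have hn : ‖v‖ ≠ 0 := norm_ne_zero_iff.2 hv
    have h1 : ‖v‖⁻¹ • v ∈ Metric.sphere (0 : E) 1 := by simp [norm_smul, hv]
    have h2 : B w w ≤ B (‖v‖⁻¹ • v) (‖v‖⁻¹ • v) := hmin h1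
    simp only [map_smul, _root_.smul_apply, smul_eq_mul] at h2
    calc B w w * ‖v‖ ^ 2 ≤ (‖v‖⁻¹ * (‖v‖⁻¹ * B v v)) * ‖v‖ ^ 2 := by gcongr
      _ = B v v := by field_simp

theorem eventually_norm_le {X V : Type*} [TopologicalSpace X] [NormedAddCommGroup V]
    {f : X → V} {s : Set X} {x : X} (hf : ContinuousWithinAt f s x) :
    ∀ᶠ z in 𝓝[s] x, ‖f z‖ ≤ ‖f x‖ + 1 :=
  (hf.norm.eventually_lt continuousWithinAt_const (lt_add_one _)).mono fun _ h => h.le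

/-- Near a point, the first derivative and the Hessian of a function are bounded on unit vectors
of the metric. -/
theorem exists_eventually_coordHessian_le [FiniteDimensional ℝ E] (hS : UniqueDiffOn ℝ S)
    (hy : y ∈ S) (hG : ContDiffWithinAt ℝ 2 G S y) (hpos : ∀ v, v ≠ 0 → 0 < G y v v)
    (hF : ContDiffWithinAt ℝ 2 F S y) :
    ∃ C, ∀ᶠ z in 𝓝[S] y, ∀ u v, G z u u ≤ 1 → G z v v ≤ 1 →
      |coordHessian S G F z u v| ≤ C ∧ |fderivWithin ℝ F S z u| ≤ C := by
  obtain ⟨m, hm, hB⟩ := exists_le_of_pos hpos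
  set a := ‖fderivWithin ℝ G S y‖ + 1
  set b := ‖fderivWithin ℝ F S y‖ + 1
  set d := ‖fderivWithin ℝ (fderivWithin ℝ F S) S y‖ + 1
  have ha : 0 ≤ a := by positivity
  have hb : 0 ≤ b := by positivity
  have hd : 0 ≤ d := by positivity
  -- Half of the coercivity constant at `y` survives for `G z` when `‖G z - G y‖ < m / 2`; metric
  -- unit balls then lie in the norm ball of radius `R = √(1 / μ)`.
  set μ := m / 2 with hμdef
  have hμ : 0 < μ := by positivity
  set R := √(1 / μ) with hR
  have hR0 : 0 ≤ R := Real.sqrt_nonneg _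
  have e1 : ∀ᶠ z in 𝓝[S] y, ‖fderivWithin ℝ G S z‖ ≤ a :=
    eventually_norm_le (hG.differentiableWithinAt_fderivWithin hS hy).continuousWithinAt
  have hF1 := hF.fderivWithin_right (m := 1) hS (by norm_num) hy
  have e2 : ∀ᶠ z in 𝓝[S] y, ‖fderivWithin ℝ F S z‖ ≤ b :=
    eventually_norm_le hF1.continuousWithinAt
  have e3 : ∀ᶠ z in 𝓝[S] y, ‖fderivWithin ℝ (fderivWithin ℝ F S) S z‖ ≤ d :=
    eventually_norm_le
      (hF1.fderivWithin_right (m := 0) hS (by norm_num) hy).continuousWithinAt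
  have e4 : ∀ᶠ z in 𝓝[S] y, ‖G z - G y‖ < μ :=
    (hG.continuousWithinAt.sub continuousWithinAt_const).norm.eventually_lt
      continuousWithinAt_const (by simpa using hμ)
  refine ⟨max (d * R * R + b * (3 / 2 * a * R * R / μ)) (b * R), ?_⟩
  filter_upwards [e1, e2, e3, e4] with z h1 h2 h3 h4 u v hu hv
  have hcoer : ∀ w, μ * ‖w‖ ^ 2 ≤ G z w w := by
    intro w
    have h5 : |(G z - G y) w w| ≤ μ * ‖w‖ * ‖w‖ :=
      ((G z - G y).le_opNorm₂ w w).trans (by gcongr)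
    have h6 : (G z - G y) w w = G z w w - G y w w := rfl
    have := hB w
    rw [h6] at h5
    have := (abs_le.1 h5).1
    nlinarith
  have hbd : ∀ w, G z w w ≤ 1 → ‖w‖ ≤ R := by
    intro w hw
    apply Real.le_sqrt_of_sq_le
    rw [le_div_iff₀ hμ]
    linarith [hcoer w]
  have hu' := hbd u hu
  have hv' := hbd v hv
  have hinv : (G z).IsInvertible := isInvertible_of_pos fun w hw =>
    lt_of_lt_of_le (by have := norm_pos_iff.2 hw; positivity) (hcoer w)
  set Γ := christoffel S G z u v with hΓdef
  have hthree : ∀ p q r : E, |fderivWithin ℝ G S z p q r| ≤ a * ‖p‖ * ‖q‖ * ‖r‖ := by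
    intro p q r
    calc |fderivWithin ℝ G S z p q r| ≤ ‖fderivWithin ℝ G S z p‖ * ‖q‖ * ‖r‖ :=
          (fderivWithin ℝ G S z p).le_opNorm₂ q r
      _ ≤ _ := by
          gcongr
          exact ((fderivWithin ℝ G S z).le_opNorm p).trans (by gcongr)
  have hΓ : ‖Γ‖ ≤ 3 / 2 * a * R * R / μ := by
    rcases eq_or_ne Γ 0 with h0 | h0
    · rw [h0, norm_zero]; positivity
    have hn : 0 < ‖Γ‖ := norm_pos_iff.2 h0
    rw [le_div_iff₀ hμ]
    -- Testing the Koszul identity on `w = Γ` bounds `μ ‖Γ‖ ^ 2` by a multiple of `‖Γ‖`, so the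
    -- inverse metric never has to be estimated.
    have k1 := hcoer Γ
    rw [hΓdef, metric_christoffel_apply hinv, ← hΓdef] at k1
    have k2 := (abs_le.1 (hthree u v Γ)).2
    have k3 := (abs_le.1 (hthree v u Γ)).2
    have k4 := (abs_le.1 (hthree Γ u v)).1
    have k5 : μ * ‖Γ‖ ^ 2 ≤ 3 / 2 * a * ‖u‖ * ‖v‖ * ‖Γ‖ := by linarith
    have k6 : 3 / 2 * a * ‖u‖ * ‖v‖ * ‖Γ‖ ≤ 3 / 2 * a * R * R * ‖Γ‖ := by gcongr
    have k7 : (‖Γ‖ * μ) * ‖Γ‖ ≤ (3 / 2 * a * R * R) * ‖Γ‖ := by nlinarith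
    exact le_of_mul_le_mul_right k7 hn
  constructor
  · refine le_trans ?_ (le_max_left _ _)
    rw [coordHessian]
    refine (abs_sub _ _).trans (add_le_add ?_ ?_)
    · refine ((fderivWithin ℝ (fderivWithin ℝ F S) S z).le_opNorm₂ u v).trans ?_
      gcongr
    · refine ((fderivWithin ℝ F S z).le_opNorm _).trans ?_
      gcongr
  · refine le_trans ?_ (le_max_right _ _)
    refine ((fderivWithin ℝ F S z).le_opNorm _).trans ?_
    gcongr

theorem exists_eventually_coordHessian_pow_four_le [FiniteDimensional ℝ E]
    (hS : UniqueDiffOn ℝ S) (hy : y ∈ S) (hG : ContDiffWithinAt ℝ 2 G S y)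
    (hpos : ∀ v, v ≠ 0 → 0 < G y v v) (hF : ContDiffWithinAt ℝ 2 F S y)
    (hF01 : ∀ z, F z ∈ Icc (0 : ℝ) 1) :
    ∃ C, ∀ᶠ z in 𝓝[S] y, ∀ u v, G z u u ≤ 1 → G z v v ≤ 1 →
      |coordHessian S G (fun x => F x ^ 4) z u v| ≤ C * F z ^ 2 := by
  obtain ⟨C, hC⟩ := exists_eventually_coordHessian_le hS hy hG hpos hF
  have hF2 := hF.eventually (by simp)
  rw [insert_eq_of_mem hy] at hF2
  refine ⟨4 * C + 12 * (C * C), ?_⟩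
  filter_upwards [hC, hF2, self_mem_nhdsWithin] with z hz hFz hzS u v hu hv
  obtain ⟨h1, h2⟩ := hz u v hu hv
  -- Exchanging `u` and `v` gives the bound on the differential at `v`.
  obtain ⟨-, h3⟩ := hz v u hv hu
  obtain ⟨h0, h01⟩ := hF01 z
  have hC0 : 0 ≤ C := (abs_nonneg _).trans h1
  rw [coordHessian_pow_four hS hzS hFz]
  refine (abs_add_le _ _).trans ?_
  rw [abs_mul, abs_mul _ (_ * _), abs_mul (fderivWithin ℝ F S z u),
    abs_of_nonneg (by positivity : 0 ≤ 4 * F z ^ 3),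
    abs_of_nonneg (by positivity : 0 ≤ 12 * F z ^ 2)]
  have h4 : F z ^ 3 ≤ F z ^ 2 := pow_le_pow_of_le_one h0 h01 (by norm_num)
  calc _ ≤ 4 * F z ^ 2 * C + 12 * F z ^ 2 * (C * C) := by gcongr
    _ = _ := by ring

end Coordinates

/-! ### Transfer to the manifold and globalisation by compactness. -/

section Manifold

variable {E : Type*} [NormedAddCommGroup E] [NormedSpace ℝ E]
  {H : Type*} [TopologicalSpace H] {I : ModelWithCorners ℝ E H}
  {M : Type*} [TopologicalSpace M] [ChartedSpace H M] [IsManifold I ∞ M]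
  (g : Bundle.ContMDiffRiemannianMetric I ∞ E (fun x : M => TangentSpace I x))

/-- The inner product at `p`, as a bilinear form on the model space. -/
def modelInner (p : M) : E →L[ℝ] E →L[ℝ] ℝ := g.inner p

variable (I) in
/-- The derivative at `p` of the chart centred at `c`. -/
def chartDeriv (c p : M) : E →L[ℝ] E := mfderiv I 𝓘(ℝ, E) (extChartAt I c) p

variable (I) in
/-- The derivative at `y` of the inverse of the chart centred at `c`. -/
def chartSymmDeriv (c : M) (y : E) : E →L[ℝ] E :=
  mfderivWithin 𝓘(ℝ, E) I (extChartAt I c).symm (range I) y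

theorem coordMetric_apply (c : M) (y u v : E) :
    coordMetric g c y u v = modelInner g ((extChartAt I c).symm y)
      (chartSymmDeriv I c y u) (chartSymmDeriv I c y v) :=
  rfl

theorem chartSymmDeriv_chartDeriv {c p : M} (hp : p ∈ (extChartAt I c).source) (a : E) :
    chartSymmDeriv I c (extChartAt I c p) (chartDeriv I c p a) = a := by
  have : IsManifold I 1 M := .of_le (n := ∞) (by simp)
  exact DFunLike.congr_fun (mfderivWithin_extChartAt_symm_comp_mfderiv_extChartAt' hp) a

theorem chartDeriv_surjective {c p : M} (hp : p ∈ (extChartAt I c).source) :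
    Function.Surjective (chartDeriv I c p) := by
  have : IsManifold I 1 M := .of_le (n := ∞) (by simp)
  exact (isInvertible_mfderiv_extChartAt hp).surjective

theorem chartSymmDeriv_injective {c : M} {y : E} (hy : y ∈ (extChartAt I c).target) :
    Function.Injective (chartSymmDeriv I c y) := by
  have : IsManifold I 1 M := .of_le (n := ∞) (by simp)
  exact (isInvertible_mfderivWithin_extChartAt_symm hy).injective

/-- A smooth bundle map applied to a constant section. These fields are the coordinate fields of the
chart at `c`, on which the metric is evaluated to get its coefficients. -/
theorem contMDiffOn_symmL_const (c : M) (u : E) :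
    ContMDiffOn I (I.prod 𝓘(ℝ, E)) ∞ (fun x => TotalSpace.mk' E (E := fun x : M => TangentSpace I x)
      x ((trivializationAt E (TangentSpace I : M → Type _) c).symmL ℝ x u))
      (trivializationAt E (TangentSpace I : M → Type _) c).baseSet := by
  intro x hx
  have h := ((trivializationAt E (TangentSpace I : M → Type _) c).contMDiffOn_symmL
    (IB := I) (n := ∞) (𝕜 := ℝ)) x hx
  have hu : ContMDiffWithinAt I (I.prod 𝓘(ℝ, E)) ∞
      (fun m : M => TotalSpace.mk' E (E := Bundle.Trivial M E) m u)
      (trivializationAt E (TangentSpace I : M → Type _) c).baseSet x := by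
    rw [contMDiffWithinAt_totalSpace]
    exact ⟨contMDiffWithinAt_id, contMDiffWithinAt_const⟩
  exact ContMDiffWithinAt.clm_bundle_apply (E₁ := Bundle.Trivial M E) (F₁ := E) (F₂ := E) h hu

theorem contDiffOn_coordMetric [FiniteDimensional ℝ E] (c : M) :
    ContDiffOn ℝ ∞ (coordMetric g c) (extChartAt I c).target := by
  have : IsManifold I 1 M := .of_le (n := ∞) (by simp)
  refine contDiffOn_clm_apply.2 fun u => contDiffOn_clm_apply.2 fun v => ?_
  rw [← contMDiffOn_iff_contDiffOn]
  set e := trivializationAt E (TangentSpace I : M → Type _) c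
  have h : ContMDiffOn I 𝓘(ℝ, ℝ) ∞
      (fun x => g.inner x (e.symmL ℝ x u) (e.symmL ℝ x v)) e.baseSet := by
    intro x hx
    have : ContMDiffWithinAt I (I.prod 𝓘(ℝ)) ∞
        (fun m ↦ TotalSpace.mk' ℝ (E := Bundle.Trivial M ℝ) m
          (g.inner m (e.symmL ℝ m u) (e.symmL ℝ m v))) e.baseSet x :=
      ContMDiffWithinAt.clm_bundle_apply₂ (F₁ := E) (F₂ := E)
        (g.contMDiff.contMDiffAt.contMDiffWithinAt)
        (contMDiffOn_symmL_const c u x hx) (contMDiffOn_symmL_const c v x hx)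
    simp only [contMDiffWithinAt_totalSpace] at this
    exact this.2
  have hmaps : MapsTo (extChartAt I c).symm (extChartAt I c).target e.baseSet := by
    intro y hy
    have := (extChartAt I c).map_target hy
    rwa [extChartAt_source] at this
  refine (h.comp (contMDiffOn_extChartAt_symm c) hmaps).congr fun y hy => ?_
  have hb : (extChartAt I c).symm y ∈ (chartAt H c).source := hmaps hy
  -- The inverse trivialization of the tangent bundle is the derivative of the inverse chart, so the
  -- smooth coefficients in `h` are those of `coordMetric`.
  have hs : ∀ w : E, (e.symmL ℝ ((extChartAt I c).symm y) w : E) = chartSymmDeriv I c y w := by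
    intro w
    have h1 : (e.symmL ℝ ((extChartAt I c).symm y) : E →L[ℝ] E) =
        chartSymmDeriv I c (extChartAt I c ((extChartAt I c).symm y)) :=
      TangentBundle.symmL_trivializationAt hb
    rw [(extChartAt I c).right_inv hy] at h1
    exact DFunLike.congr_fun h1 w
  rw [coordMetric_apply, ← hs, ← hs]
  rfl

theorem contDiffWithinAt_coordMetric [FiniteDimensional ℝ E] {c : M} {y : E}
    (hy : y ∈ (extChartAt I c).target) :
    ContDiffWithinAt ℝ ∞ (coordMetric g c) (range I) y :=
  (contDiffOn_coordMetric g c y hy).mono_of_mem_nhdsWithin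
    (extChartAt_target_mem_nhdsWithin_of_mem hy)

theorem _root_.ContMDiff.contDiffWithinAt_comp_extChartAt_symm {f : M → ℝ}
    (hf : ContMDiff I 𝓘(ℝ, ℝ) ∞ f) {c : M} {y : E} (hy : y ∈ (extChartAt I c).target) :
    ContDiffWithinAt ℝ ∞ (f ∘ (extChartAt I c).symm) (range I) y := by
  have h : ContDiffOn ℝ ∞ (f ∘ (extChartAt I c).symm) (extChartAt I c).target :=
    contMDiffOn_iff_contDiffOn.1 (hf.comp_contMDiffOn (contMDiffOn_extChartAt_symm c))
  exact (h y hy).mono_of_mem_nhdsWithin (extChartAt_target_mem_nhdsWithin_of_mem hy)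

theorem coordMetric_chartDeriv {c p : M} (hp : p ∈ (extChartAt I c).source) (a b : E) :
    coordMetric g c (extChartAt I c p) (chartDeriv I c p a) (chartDeriv I c p b) =
      modelInner g p a b := by
  rw [coordMetric_apply, chartSymmDeriv_chartDeriv hp, chartSymmDeriv_chartDeriv hp,
    (extChartAt I c).left_inv hp]

theorem coordMetric_symm (c : M) (y u v : E) : coordMetric g c y u v = coordMetric g c y v u := by
  rw [coordMetric_apply, coordMetric_apply]
  exact g.symm _ _ _

theorem coordMetric_pos {c : M} {y : E} (hy : y ∈ (extChartAt I c).target) (v : E) (hv : v ≠ 0) :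
    0 < coordMetric g c y v v := by
  rw [coordMetric_apply]
  exact g.pos _ _ fun h => hv (chartSymmDeriv_injective hy (h.trans (map_zero _).symm))

theorem fderivWithin_extChartAt_comp_symm {c c' : M} {z : E} (hz : z ∈ (extChartAt I c).target)
    (hz' : (extChartAt I c).symm z ∈ (extChartAt I c').source) :
    fderivWithin ℝ (extChartAt I c' ∘ (extChartAt I c).symm) (range I) z =
      (chartDeriv I c' ((extChartAt I c).symm z)).comp (chartSymmDeriv I c z) := by
  have : IsManifold I 1 M := .of_le (n := ∞) (by simp)
  have hzr : z ∈ range I := extChartAt_target_subset_range c hz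
  rw [← mfderivWithin_eq_fderivWithin]
  rw [extChartAt_source] at hz'
  exact mfderiv_comp_mfderivWithin (I' := I) z (mdifferentiableAt_extChartAt hz')
    (mdifferentiableWithinAt_extChartAt_symm hz)
    (I.uniqueDiffOn z hzr).uniqueMDiffWithinAt

omit [IsManifold I ∞ M] in
theorem extChartAt_mem_range (c p : M) : extChartAt I c p ∈ range I :=
  mem_range_self _

/-- The Hessian on a manifold does not depend on the chart in which it is computed. -/
theorem hessianInChart_eq [FiniteDimensional ℝ E] {f : M → ℝ} (hf : ContMDiff I 𝓘(ℝ, ℝ) ∞ f)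
    {c c' x : M} (hc : x ∈ (extChartAt I c).source) (hc' : x ∈ (extChartAt I c').source)
    (u v : TangentSpace I x) : hessianInChart g c f x u v = hessianInChart g c' f x u v := by
  have hy : extChartAt I c x ∈ (extChartAt I c).target := (extChartAt I c).map_source hc
  have hy' : extChartAt I c' x ∈ (extChartAt I c').target := (extChartAt I c').map_source hc'
  have hyr := extChartAt_mem_range (I := I) c x
  have hx := (extChartAt I c).left_inv hc
  set τ : E → E := extChartAt I c' ∘ (extChartAt I c).symm with hτdef
  have hτx : τ (extChartAt I c x) = extChartAt I c' x := by rw [hτdef, Function.comp, hx]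
  have hev : ∀ᶠ z in 𝓝[range I] (extChartAt I c x), z ∈ (extChartAt I c).target ∧
      (extChartAt I c).symm z ∈ (extChartAt I c').source := by
    have h1 : ContinuousWithinAt (extChartAt I c).symm (range I) (extChartAt I c x) :=
      (continuousAt_extChartAt_symm' hc).continuousWithinAt
    refine Filter.Eventually.and (extChartAt_target_mem_nhdsWithin' hc) (h1.eventually_mem ?_)
    rw [hx]
    exact extChartAt_source_mem_nhds' hc'
  have hτ : ContDiffWithinAt ℝ ∞ τ (range I) (extChartAt I c x) := by
    refine contDiffWithinAt_ext_coord_change c' c ?_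
    rw [PartialEquiv.trans_source]
    exact ⟨hy, by rwa [mem_preimage, hx]⟩
  have hd : ∀ w, fderivWithin ℝ τ (range I) (extChartAt I c x) (chartDeriv I c x w) =
      chartDeriv I c' x w := by
    intro w
    rw [fderivWithin_extChartAt_comp_symm hy (by rwa [hx]), ContinuousLinearMap.comp_apply,
      chartSymmDeriv_chartDeriv hc, hx]
  have hsurj : Function.Surjective (fderivWithin ℝ τ (range I) (extChartAt I c x)) := by
    intro w
    obtain ⟨w', hw'⟩ := chartDeriv_surjective hc' w
    exact ⟨_, (hd w').trans hw'⟩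
  have h2 : (2 : WithTop ℕ∞) ≤ ∞ := WithTop.coe_le_coe.2 le_top
  have key := coordHessian_comp (F := f ∘ (extChartAt I c).symm) (F' := f ∘ (extChartAt I c').symm)
    (G := coordMetric g c) (G' := coordMetric g c') I.uniqueDiffOn hyr
    (I.range_subset_closure_interior hyr) (hτ.of_le h2)
    (Eventually.of_forall fun z => extChartAt_mem_range c' _)
    (by rw [hτx]; exact (hf.contDiffWithinAt_comp_extChartAt_symm hy').of_le h2)
    (by
      filter_upwards [hev] with z hz
      rw [hτdef, Function.comp, Function.comp, Function.comp, Function.comp,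
        (extChartAt I c').left_inv hz.2])
    (by rw [hτx]; exact (contDiffWithinAt_coordMetric g hy').differentiableWithinAt (by simp))
    ((contDiffWithinAt_coordMetric g hy).differentiableWithinAt (by simp))
    (by
      filter_upwards [hev] with z hz v w
      rw [fderivWithin_extChartAt_comp_symm hz.1 hz.2]
      exact (coordMetric_chartDeriv g hz.2 _ _).symm)
    (coordMetric_symm g c' _) (isInvertible_of_pos (coordMetric_pos g hy))
    (by rw [hτx]; exact isInvertible_of_pos (coordMetric_pos g hy')) hsurj
  have key' := fun a b : E => key (chartDeriv I c x a) (chartDeriv I c x b)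
  simp only [hd, hτx] at key'
  exact key' u v

/-- The estimate is made in the single chart centred at `c`; chart independence then moves it to the
preferred chart of each nearby `x`. -/
theorem exists_eventually_hessian_pow_four_le [FiniteDimensional ℝ E] {f : M → ℝ}
    (hf : ContMDiff I 𝓘(ℝ, ℝ) ∞ f) (hf01 : ∀ x, f x ∈ Icc (0 : ℝ) 1) (c : M) :
    ∃ C, ∀ᶠ x in 𝓝 c, ∀ u v : TangentSpace I x, g.inner x u u ≤ 1 → g.inner x v v ≤ 1 →
      |hessian g (fun x => f x ^ 4) x u v| ≤ C * f x ^ 2 := by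
  have h2 : (2 : WithTop ℕ∞) ≤ ∞ := WithTop.coe_le_coe.2 le_top
  have hy := mem_extChartAt_target (I := I) c
  obtain ⟨C, hC⟩ := exists_eventually_coordHessian_pow_four_le I.uniqueDiffOn
    (extChartAt_target_subset_range c hy) ((contDiffWithinAt_coordMetric g hy).of_le h2)
    (coordMetric_pos g hy) ((hf.contDiffWithinAt_comp_extChartAt_symm hy).of_le h2)
    (fun z => hf01 _)
  have ht : Tendsto (extChartAt I c) (𝓝 c) (𝓝[range I] (extChartAt I c c)) :=
    tendsto_nhdsWithin_iff.2 ⟨continuousAt_extChartAt c,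
      Eventually.of_forall fun z => extChartAt_mem_range c z⟩
  refine ⟨C, ?_⟩
  filter_upwards [ht.eventually hC, extChartAt_source_mem_nhds (I := I) c] with x hx hxs u v hu hv
  have := hx (chartDeriv I c x u) (chartDeriv I c x v)
    ((coordMetric_chartDeriv g hxs u u).trans_le hu)
    ((coordMetric_chartDeriv g hxs v v).trans_le hv)
  rw [hessian, hessianInChart_eq g (hf.pow 4) (mem_extChartAt_source x) hxs]
  rw [Function.comp, (extChartAt I c).left_inv hxs] at this
  exact this

/-- On a compact manifold, `‖∇²(f⁴)‖² ≤ C f⁴` for every smooth `f` with values in `[0, 1]`, because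
`∇²(f⁴) = 4 f³ ∇²f + 12 f² df ⊗ df`. -/
theorem exists_hessianNormSq_pow_four_le [FiniteDimensional ℝ E] [CompactSpace M] {f : M → ℝ}
    (hf : ContMDiff I 𝓘(ℝ, ℝ) ∞ f) (hf01 : ∀ x, f x ∈ Icc (0 : ℝ) 1)
    (ι : Type*) [Fintype ι] :
    ∃ C, ∀ x, ∀ e : Module.Basis ι ℝ (TangentSpace I x), IsOrthonormalBasis g e →
      hessianNormSq g (fun x => f x ^ 4) e ≤ C * f x ^ 4 := by
  choose C hC using exists_eventually_hessian_pow_four_le g hf hf01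
  obtain ⟨t, -, ht⟩ := isCompact_univ.elim_nhds_subcover _ fun c _ => hC c
  -- The sum over the finite subcover dominates each local constant `C c ^ 2`; it is counted once
  -- for every pair `(i, j)`.
  refine ⟨∑ _i : ι, ∑ _j : ι, ∑ c ∈ t, C c ^ 2, fun x e he => ?_⟩
  obtain ⟨c, hct, hc⟩ := mem_iUnion₂.1 (ht (mem_univ x))
  simp only [hessianNormSq, Finset.sum_mul]
  refine Finset.sum_le_sum fun i _ => Finset.sum_le_sum fun j _ => ?_
  have h1 := hc (e i) (e j) (he.1 i).le (he.1 j).le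
  rw [← Finset.sum_mul]
  calc hessian g (fun x => f x ^ 4) x (e i) (e j) ^ 2 ≤ (C c * f x ^ 2) ^ 2 :=
        sq_le_sq' (abs_le.1 h1).1 (abs_le.1 h1).2
    _ = C c ^ 2 * f x ^ 4 := by ring
    _ ≤ (∑ c ∈ t, C c ^ 2) * f x ^ 4 := by
        gcongr
        exact Finset.single_le_sum (f := fun c => C c ^ 2) (fun _ _ => sq_nonneg _) hct

end Manifold

end RiemHess

end

theorem mainTheorem6
    {E : Type*} [NormedAddCommGroup E] [NormedSpace ℝ E] [FiniteDimensional ℝ E]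
    {H : Type*} [TopologicalSpace H] (I : ModelWithCorners ℝ E H)
    {M : Type*} [TopologicalSpace M] [T2Space M] [ChartedSpace H M] [IsManifold I ∞ M]
    [CompactSpace M] [ConnectedSpace M]
    (g : Bundle.ContMDiffRiemannianMetric I ∞ E (fun x : M => TangentSpace I x))
    (U V : Set M) (hU : IsOpen U) (hV : IsOpen V)
    (hUs : RiemHess.HasSmoothBoundary I U) (hVs : RiemHess.HasSmoothBoundary I V)
    (hUV : Disjoint (closure U) (closure V)) (hM : I.boundary M ⊆ U) :
    ∃ η : M → ℝ, ContMDiff I 𝓘(ℝ, ℝ) ∞ η ∧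
      (∀ x, η x ∈ Set.Icc (0 : ℝ) 1) ∧
      (∀ x ∈ closure U, η x = 1) ∧
      (∀ x ∈ closure V, η x = 0) ∧
      (∀ x, x ∉ closure U ∪ closure V → η x ∈ Set.Ioo (0 : ℝ) 1) ∧
      ∃ C : ℝ, ∀ x, x ∉ closure V →
        ∀ e : Module.Basis (Fin (Module.finrank ℝ E)) ℝ (TangentSpace I x),
          RiemHess.IsOrthonormalBasis g e → RiemHess.hessianNormSq g η e / |η x| ≤ C := by
  obtain ⟨f, hf, hrange, h0, h1⟩ := exists_contMDiff_zero_iff_one_iff_of_isClosed (n := ⊤) I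
    (isClosed_closure (s := V)) (isClosed_closure (s := U)) hUV.symm
  have hf01 : ∀ x, f x ∈ Set.Icc (0 : ℝ) 1 := fun x => hrange ⟨x, rfl⟩
  obtain ⟨C, hC⟩ := RiemHess.exists_hessianNormSq_pow_four_le g hf hf01
    (Fin (Module.finrank ℝ E))
  refine ⟨fun x => f x ^ 4, hf.pow 4, fun x => ⟨pow_nonneg (hf01 x).1 4,
    pow_le_one₀ (hf01 x).1 (hf01 x).2⟩, fun x hx => by simp [(h1 x).1 hx],
    fun x hx => by simp [(h0 x).1 hx], fun x hx => ?_, C, fun x hx e he => ?_⟩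
  · rw [Set.mem_union, not_or, h0, h1] at hx
    exact ⟨pow_pos (lt_of_le_of_ne (hf01 x).1 (Ne.symm hx.2)) 4,
      pow_lt_one₀ (hf01 x).1 (lt_of_le_of_ne (hf01 x).2 hx.1) (by norm_num)⟩
  · have hpos : 0 < f x ^ 4 :=
      pow_pos (lt_of_le_of_ne (hf01 x).1 fun h => hx ((h0 x).2 h.symm)) 4
    rw [abs_of_pos hpos, div_le_iff₀ hpos]
    exact hC x e he
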